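/- **Theorem (Projection-gap identity for the lifted bridge).** Let $d\in\mathbb N$, $\varepsilon>0$, and let $\Omega=C([0,1];\mathbb R^d)$ with its Borel $\sigma$-algebra and canonical process $(x_t)_{t\in[0,1]}$. Let $N_1,N_2\ge 1$, let $\alpha^0\in(0,1]^{N_1}$ and $\alpha^1\in(0,1]^{N_2}$ have entries summing to $1$, and let $p_i^0=\mathcal N(m_i^0,\Sigma_i^0)$ and $p_j^1=\mathcal N(m_j^1,\Sigma_j^1)$ be Gaussian laws on $\mathbb R^d$ with positive definite covariances. For $1\le i\le N_1$ let $\mathsf R^i$ be the law on $\Omega$ of the solution of $\mathrm dx_t=\sqrt{\varepsilon}\,\mathrm dw_t$, $x_0\sim p_i^0$, where $w$ is a standard Brownian motion independent of $x_0$. For each pair $(i,j)$ let $\mathsf P^{ij}$ be the pairwise Schrödinger bridge, i.e. a minimizer of $\mathrm{KL}(\mathsf Q\|\mathsf R^i)$ over all probability measures $\mathsf Q$ on $\Omega$ under which $x_0\sim p_i^0$ and $x_1\sim p_j^1$. Put $\kappa_{ij}=\mathrm{KL}(\mathsf P^{ij}\|\mathsf R^i)$ and $C_{ij}=\varepsilon\kappa_{ij}$.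 Let $\Pi(\alpha^0,\alpha^1)$ be the set of nonnegative $N_1\times N_2$ matrices with row sums $\alpha_i^0$ and column sums $\alpha_j^1$. Let $\pi,\eta\in\Pi(\alpha^0,\alpha^1)$ satisfy $\operatorname{supp}\pi\subseteq\operatorname{supp}\eta$, that is, $\pi_{ij}>0$ implies $\eta_{ij}>0$, and put $\mathrm{KL}(\pi\|\eta)=\sum_{i,j}\pi_{ij}\log(\pi_{ij}/\eta_{ij})$ (terms with $\pi_{ij}=0$ being $0$). On $\mathcal Z\times\Omega$, where $\mathcal Z=\{1,\dots,N_1\}\times\{1,\dots,N_2\}$, define the lifted law and the lifted reference $$\bar{\mathsf P}^\pi=\sum_{i,j}\pi_{ij}\,\delta_{(i,j)}\otimes\mathsf P^{ij},\qquad \bar{\mathsf R}^\eta=\sum_{i,j}\eta_{ij}\,\delta_{(i,j)}\otimes\mathsf R^{i},$$ and let $\mathsf Q^\pi$ and $\mathsf R^{\rho_0}$ be their respective images under the projection $(z,\omega)\mapsto\omega$. Writing $\bar{\mathsf P}^\pi(Z\mid x_{0:1})$ and $\bar{\mathsf R}^\eta(Z\mid x_{0:1})$ for the conditional laws of the label $Z$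 given the full path, define $$\mathcal G(\pi,\eta)=\mathbb E^{\mathsf Q^\pi}\Big[\mathrm{KL}\big(\bar{\mathsf P}^\pi(Z\mid x_{0:1})\,\big\|\,\bar{\mathsf R}^\eta(Z\mid x_{0:1})\big)\Big].$$ Then $\mathcal G(\pi,\eta)\ge 0$ and $$\mathrm{KL}(\bar{\mathsf P}^\pi\|\bar{\mathsf R}^\eta)=\mathrm{KL}(\mathsf Q^\pi\|\mathsf R^{\rho_0})+\mathcal G(\pi,\eta).$$ Consequently, all of these quantities and all $\kappa_{ij}$ being finite, $$\mathrm{KL}(\mathsf Q^\pi\|\mathsf R^{\rho_0})=\sum_{i,j}\pi_{ij}\kappa_{ij}+\mathrm{KL}(\pi\|\eta)-\mathcal G(\pi,\eta),$$ equivalently $$\varepsilon\,\mathrm{KL}(\mathsf Q^\pi\|\mathsf R^{\rho_0})=\sum_{i,j}\pi_{ij}C_{ij}+\varepsilon\,\mathrm{KL}(\pi\|\eta)-\varepsilon\,\mathcal G(\pi,\eta).$$ -/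

import Mathlib

open MeasureTheory ProbabilityTheory InformationTheory
open scoped ENNReal

namespace LiftedBridge

/-- The state space `ℝ^d` with its Euclidean norm. -/
abbrev State (d : ℕ) : Type := EuclideanSpace ℝ (Fin d)

/-- The path space `C([0,1]; ℝ^d)` with the uniform topology. -/
abbrev PathSpace (d : ℕ) : Type := C(unitInterval, State d)

instance (d : ℕ) : MeasurableSpace (PathSpace d) := borel _

instance (d : ℕ) : BorelSpace (PathSpace d) := ⟨rfl⟩

/-- The space of labels `(i, j)`. -/
abbrev Label (N₁ N₂ : ℕ) : Type := Fin N₁ × Fin N₂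

/-- `W` is the Wiener measure, i.e. the law on path space of a standard `ℝ^d`-valued Brownian
motion: the canonical process starts at `0`, has independent increments, and the increment over
`[s, t]` has law `N(0, (t - s) I)`. -/
structure IsWienerMeasure {d : ℕ} (W : ProbabilityMeasure (PathSpace d)) : Prop where
  start_zero : ∀ᵐ w ∂(W : Measure (PathSpace d)), w 0 = 0
  indep_increments :
    HasIndepIncrements (fun (t : unitInterval) (w : PathSpace d) => w t) (W : Measure (PathSpace d))
  increment_law : ∀ s t : unitInterval, s ≤ t →
    (W : Measure (PathSpace d)).map (fun w => w t - w s) =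
      multivariateGaussian 0 (((t : ℝ) - (s : ℝ)) • (1 : Matrix (Fin d) (Fin d) ℝ))

/-- The Gaussian law `N(m, S)` on `ℝ^d`. -/
noncomputable def gaussian {d : ℕ} (m : State d) (S : Matrix (Fin d) (Fin d) ℝ) :
    ProbabilityMeasure (State d) :=
  ⟨multivariateGaussian m S, inferInstance⟩

/-- The path `t ↦ x + √ε w_t`, the solution of `dx_t = √ε dw_t` started at `x`. -/
noncomputable def uncontrolledPath {d : ℕ} (ε : ℝ) (q : State d × PathSpace d) : PathSpace d :=
  ContinuousMap.const unitInterval q.1 + Real.sqrt ε • q.2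

theorem measurable_uncontrolledPath {d : ℕ} (ε : ℝ) :
    Measurable (uncontrolledPath (d := d) ε) := by
  have h : Continuous (uncontrolledPath (d := d) ε) := by
    unfold uncontrolledPath
    exact (ContinuousMap.continuous_const'.comp continuous_fst).add
      (continuous_snd.const_smul (Real.sqrt ε))
  exact h.measurable

/-- The reference law `R^ν`: the law on path space of the uncontrolled diffusion
`dx_t = √ε dw_t` with `x_0 ∼ ν` independent of the Brownian motion `w`, whose law is `W`. -/
noncomputable def referenceLaw {d : ℕ} (ε : ℝ) (W : ProbabilityMeasure (PathSpace d))
    (ν : ProbabilityMeasure (State d)) : ProbabilityMeasure (PathSpace d) :=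
  ⟨((ν : Measure (State d)).prod (W : Measure (PathSpace d))).map (uncontrolledPath ε),
    Measure.isProbabilityMeasure_map (measurable_uncontrolledPath ε).aemeasurable⟩

/-- `Q` has initial law `μ` and terminal law `ν`. -/
def HasEndpoints {d : ℕ} (Q : ProbabilityMeasure (PathSpace d))
    (μ ν : ProbabilityMeasure (State d)) : Prop :=
  (Q : Measure (PathSpace d)).map (fun x => x 0) = μ ∧
    (Q : Measure (PathSpace d)).map (fun x => x 1) = ν

/-- `P` is a Schrödinger bridge from `μ` to `ν` relative to `R`: it minimizes `KL(· ‖ R)` among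
the path laws with endpoint laws `μ` and `ν`. -/
def IsSchrodingerBridge {d : ℕ} (R : ProbabilityMeasure (PathSpace d))
    (μ ν : ProbabilityMeasure (State d)) (P : ProbabilityMeasure (PathSpace d)) : Prop :=
  HasEndpoints P μ ν ∧
    ∀ Q : ProbabilityMeasure (PathSpace d), HasEndpoints Q μ ν →
      klDiv (P : Measure (PathSpace d)) R ≤ klDiv (Q : Measure (PathSpace d)) R

/-- The set `Π(α⁰, α¹)` of component couplings. -/
def couplings {N₁ N₂ : ℕ} (α₀ : Fin N₁ → ℝ) (α₁ : Fin N₂ → ℝ) :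
    Set (Matrix (Fin N₁) (Fin N₂) ℝ) :=
  {π | (∀ i j, 0 ≤ π i j) ∧ (∀ i, ∑ j, π i j = α₀ i) ∧ (∀ j, ∑ i, π i j = α₁ j)}

/-- The support `{(i, j) | π_ij > 0}` of a matrix. -/
def matrixSupport {N₁ N₂ : ℕ} (π : Matrix (Fin N₁) (Fin N₂) ℝ) : Set (Label N₁ N₂) :=
  {z | 0 < π z.1 z.2}

/-- The divergence `KL(π ‖ η) = ∑ π_ij log (π_ij / η_ij)` of couplings, with `0 log 0 = 0`;
it is meant for `supp π ⊆ supp η`. -/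
noncomputable def couplingKL {N₁ N₂ : ℕ} (π η : Matrix (Fin N₁) (Fin N₂) ℝ) : ℝ :=
  ∑ i, ∑ j, π i j * Real.log (π i j / η i j)

/-- The law `∑ π_ij δ_(i,j) ⊗ Q^{ij}` on labels times paths. -/
noncomputable def liftedLaw {d N₁ N₂ : ℕ} (π : Matrix (Fin N₁) (Fin N₂) ℝ)
    (Q : Fin N₁ → Fin N₂ → ProbabilityMeasure (PathSpace d)) :
    Measure (Label N₁ N₂ × PathSpace d) :=
  ∑ i, ∑ j, ENNReal.ofReal (π i j) •
    (Measure.dirac ((i, j) : Label N₁ N₂)).prod (Q i j : Measure (PathSpace d))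

instance {d N₁ N₂ : ℕ} (π : Matrix (Fin N₁) (Fin N₂) ℝ)
    (Q : Fin N₁ → Fin N₂ → ProbabilityMeasure (PathSpace d)) :
    IsFiniteMeasure (liftedLaw π Q) := by
  refine ⟨?_⟩
  simp only [liftedLaw, Measure.coe_finsetSum, Finset.sum_apply, Measure.smul_apply, smul_eq_mul,
    measure_univ, mul_one]
  exact ENNReal.sum_lt_top.2 fun i _ => ENNReal.sum_lt_top.2 fun j _ => ENNReal.ofReal_lt_top

/-- The path-space marginal of a law on labels times paths (the label is forgotten). -/
noncomputable def pathMarginal {d N₁ N₂ : ℕ} (M : Measure (Label N₁ N₂ × PathSpace d)) :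
    Measure (PathSpace d) :=
  M.map Prod.snd

/-- The posterior law `M(Z ∣ x_{0:1} = ·)` of the label given the full path, as a regular
conditional distribution. -/
noncomputable def labelPosterior {d N₁ N₂ : ℕ} [NeZero N₁] [NeZero N₂]
    (M : Measure (Label N₁ N₂ × PathSpace d)) [IsFiniteMeasure M] :
    Kernel (PathSpace d) (Label N₁ N₂) :=
  condDistrib Prod.fst Prod.snd M

/-- The conditional label-information gap between `M` and `M'`: the expectation, under the path
marginal of `M`, of the relative entropy of the posterior label laws given the full path. -/
noncomputable def labelGap {d N₁ N₂ : ℕ} [NeZero N₁] [NeZero N₂]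
    (M M' : Measure (Label N₁ N₂ × PathSpace d)) [IsFiniteMeasure M] [IsFiniteMeasure M'] :
    ℝ≥0∞ :=
  ∫⁻ x, klDiv (labelPosterior M x) (labelPosterior M' x) ∂(pathMarginal M)

end LiftedBridge

/-!
The identity is the chain rule for relative entropy applied twice to the lifted laws on labels
times paths, once in each order of disintegration.

Disintegrating along the path, `M = pathMarginal M ⊗ₘ labelPosterior M` up to swapping the factors,
so the chain rule splits `klDiv Pbar Rbar` into the entropy of the path marginals plus a conditional
entropy of the labels. The latter is the average of the pointwise entropies of the posteriors, i.e.
the label gap (`InformationTheory.klDiv_compProd_right_eq_lintegral`,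
`LiftedBridge.klDiv_eq_klDiv_pathMarginal_add_labelGap`). Disintegrating along the label, the same
entropy is the entropy of the label laws plus the `π`-average of the component entropies
(`LiftedBridge.klDiv_liftedLaw`). Equating the two expressions gives the theorem once everything is
known to be finite.

Finiteness reduces to that of the entropy of each pairwise bridge, and by optimality it suffices to
find one competitor of finite entropy (`LiftedBridge.IsSchrodingerBridge.klDiv_ne_top`). Reweighting
the reference law by a function of the endpoints produces a path law whose endpoints are independent
with the prescribed laws, and whose entropy is that of the product of the two Gaussians relative to
the endpoint law of the reference
(`InformationTheory.exists_map_eq_and_klDiv_ne_top`). Both are images of standard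
Gaussians under invertible affine maps, so their log-densities with respect to Lebesgue measure grow
at most quadratically, while the product has finite second moments; hence the relative entropy is
finite (`ProbabilityTheory.HasQuadraticLogDensity.klDiv_ne_top`).
-/

namespace InformationTheory

/-! ### Conditional relative entropy -/

section Conditional

variable {𝓧 𝓨 : Type*} {m𝓧 : MeasurableSpace 𝓧} {m𝓨 : MeasurableSpace 𝓨}

lemma klDiv_map_measurableEquiv (μ ν : Measure 𝓧) [IsFiniteMeasure μ] [IsFiniteMeasure ν]
    (e : 𝓧 ≃ᵐ 𝓨) : klDiv (μ.map e) (ν.map e) = klDiv μ ν := by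
  refine le_antisymm (klDiv_map_le μ ν e.measurable) ?_
  have h := klDiv_map_le (μ.map e) (ν.map e) e.symm.measurable
  simpa [Measure.map_map e.symm.measurable e.measurable] using h

variable [MeasurableSpace.CountableOrCountablyGenerated 𝓧 𝓨] {μ : Measure 𝓧}
  {κ η : Kernel 𝓧 𝓨} [IsMarkovKernel κ] [IsMarkovKernel η]

/-- Unlike `∂(κ x)/∂(η x)`, the kernel derivative is jointly measurable in `x` and `y`. -/
lemma klDiv_kernel_eq_lintegral_klFun {x : 𝓧} (h : κ x ≪ η x) :
    klDiv (κ x) (η x) =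
      ∫⁻ y, ENNReal.ofReal (klFun (κ.rnDeriv η x y).toReal) ∂(η x) := by
  rw [klDiv_eq_lintegral_klFun_of_ac h]
  refine lintegral_congr_ae ?_
  filter_upwards [Kernel.rnDeriv_eq_rnDeriv_measure (κ := κ) (η := η) (a := x)] with y hy
  rw [hy]

lemma aemeasurable_klDiv_kernel (h : ∀ᵐ x ∂μ, κ x ≪ η x) :
    AEMeasurable (fun x => klDiv (κ x) (η x)) μ := by
  refine ⟨fun x => ∫⁻ y, ENNReal.ofReal (klFun (κ.rnDeriv η x y).toReal) ∂(η x), ?_, ?_⟩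
  · refine Measurable.lintegral_kernel_prod_right' (κ := η)
      (f := fun p => ENNReal.ofReal (klFun (κ.rnDeriv η p.1 p.2).toReal)) ?_
    exact (measurable_klFun.comp (Kernel.measurable_rnDeriv κ η).ennreal_toReal).ennreal_ofReal
  · filter_upwards [h] with x hx
    exact klDiv_kernel_eq_lintegral_klFun hx

/-- The conditional relative entropy is the average of the pointwise relative entropies. -/
lemma klDiv_compProd_right_eq_lintegral [IsFiniteMeasure μ] (h : ∀ᵐ x ∂μ, κ x ≪ η x) :
    klDiv (μ ⊗ₘ κ) (μ ⊗ₘ η) = ∫⁻ x, klDiv (κ x) (η x) ∂μ := by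
  have hac : μ ⊗ₘ κ ≪ μ ⊗ₘ η := Measure.AbsolutelyContinuous.compProd_right h
  have hmeas : Measurable
      (fun p : 𝓧 × 𝓨 => ENNReal.ofReal (klFun (κ.rnDeriv η p.1 p.2).toReal)) :=
    (measurable_klFun.comp (Kernel.measurable_rnDeriv κ η).ennreal_toReal).ennreal_ofReal
  have hd : μ ⊗ₘ κ = (μ ⊗ₘ η).withDensity (fun p => κ.rnDeriv η p.1 p.2) := by
    rw [← Measure.compProd_withDensity (Kernel.measurable_rnDeriv κ η)]
    refine Measure.compProd_congr ?_
    filter_upwards [h] with x hx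
    exact (Kernel.withDensity_rnDeriv_eq hx).symm
  have hr : (μ ⊗ₘ κ).rnDeriv (μ ⊗ₘ η) =ᵐ[μ ⊗ₘ η] fun p => κ.rnDeriv η p.1 p.2 := by
    conv_lhs => rw [hd]
    exact Measure.rnDeriv_withDensity _ (Kernel.measurable_rnDeriv κ η)
  rw [klDiv_eq_lintegral_klFun_of_ac hac]
  calc _ = ∫⁻ p, ENNReal.ofReal (klFun (κ.rnDeriv η p.1 p.2).toReal) ∂(μ ⊗ₘ η) := by
        refine lintegral_congr_ae ?_
        filter_upwards [hr] with p hp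
        rw [hp]
    _ = ∫⁻ x, ∫⁻ y, ENNReal.ofReal (klFun (κ.rnDeriv η x y).toReal) ∂(η x) ∂μ :=
        Measure.lintegral_compProd hmeas
    _ = _ := by
        refine lintegral_congr_ae ?_
        filter_upwards [h] with x hx
        exact (klDiv_kernel_eq_lintegral_klFun hx).symm

/-- For probability kernels the mass corrections in `klDiv` cancel, so the averaged log-likelihood
ratio is the averaged relative entropy. -/
lemma integral_integral_llr_eq_toReal (h : ∀ᵐ x ∂μ, κ x ≪ η x)
    (hfin : ∫⁻ x, klDiv (κ x) (η x) ∂μ ≠ ∞) :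
    ∫ x, (∫ y, llr (κ x) (η x) y ∂(κ x)) ∂μ = (∫⁻ x, klDiv (κ x) (η x) ∂μ).toReal := by
  have hm := aemeasurable_klDiv_kernel h
  rw [← integral_toReal hm (ae_lt_top' hm hfin)]
  refine integral_congr_ae ?_
  filter_upwards [h] with x hx
  exact (toReal_klDiv_of_measure_eq hx (by simp)).symm

end Conditional

/-! ### Lifting laws of finite relative entropy -/

section Lift

variable {Ω 𝓧 : Type*} {mΩ : MeasurableSpace Ω} {m𝓧 : MeasurableSpace 𝓧}

/-- A law `ρ` of finite entropy relative to the image of `R` lifts to a law of finite entropy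
relative to `R`: reweight `R` by the density of `ρ` evaluated along `e`. -/
lemma exists_map_eq_and_klDiv_ne_top {R : Measure Ω} [IsProbabilityMeasure R] {e : Ω → 𝓧}
    (he : Measurable e) {ρ : Measure 𝓧} [IsProbabilityMeasure ρ]
    (h : klDiv ρ (R.map e) ≠ ∞) :
    ∃ Q : Measure Ω, IsProbabilityMeasure Q ∧ Q.map e = ρ ∧ klDiv Q R ≠ ∞ := by
  obtain ⟨hac, hint⟩ := klDiv_ne_top_iff.1 h
  have : IsProbabilityMeasure (R.map e) := Measure.isProbabilityMeasure_map he.aemeasurable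
  set f := ρ.rnDeriv (R.map e) with hf
  have hfm : Measurable f := Measure.measurable_rnDeriv _ _
  have hmap : (R.withDensity (f ∘ e)).map e = ρ := by
    rw [← Measure.withDensity_rnDeriv_eq _ _ hac]
    ext s hs
    rw [Measure.map_apply he hs, withDensity_apply _ (he hs), withDensity_apply _ hs,
      setLIntegral_map hs hfm he]
    rfl
  have hprob : IsProbabilityMeasure (R.withDensity (f ∘ e)) := by
    constructor
    rw [← Set.preimage_univ (f := e), ← Measure.map_apply he .univ, hmap, measure_univ]
  have hQac : R.withDensity (f ∘ e) ≪ R := withDensity_absolutelyContinuous _ _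
  refine ⟨R.withDensity (f ∘ e), hprob, hmap, klDiv_ne_top hQac ?_⟩
  have hr : (R.withDensity (f ∘ e)).rnDeriv R =ᵐ[R] f ∘ e :=
    Measure.rnDeriv_withDensity _ (hfm.comp he)
  have hllr : llr (R.withDensity (f ∘ e)) R =ᵐ[R.withDensity (f ∘ e)] llr ρ (R.map e) ∘ e := by
    filter_upwards [hQac.ae_le hr] with ω hω
    simp only [llr, Function.comp_apply] at hω ⊢
    rw [hω]
  rw [integrable_congr hllr, ← integrable_map_measure _ he.aemeasurable, hmap]
  · exact hint
  · exact (measurable_llr _ _).aestronglyMeasurable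

end Lift

/-! ### Relative entropy on finite types -/

section Discrete

variable {ι : Type*} [Fintype ι] [MeasurableSpace ι] [MeasurableSingletonClass ι]

/-- The measure on a finite type with mass `max (w i) 0` at `i`. -/
noncomputable def weightMeasure (w : ι → ℝ) : Measure ι :=
  ∑ i, ENNReal.ofReal (w i) • Measure.dirac i

instance (w : ι → ℝ) : IsFiniteMeasure (weightMeasure w) := by
  refine ⟨?_⟩
  simp only [weightMeasure, Measure.coe_finsetSum, Finset.sum_apply, Measure.smul_apply,
    smul_eq_mul, measure_univ, mul_one]
  exact ENNReal.sum_lt_top.2 fun i _ => ENNReal.ofReal_lt_top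

lemma lintegral_weightMeasure (w : ι → ℝ) (f : ι → ℝ≥0∞) :
    ∫⁻ i, f i ∂(weightMeasure w) = ∑ i, ENNReal.ofReal (w i) * f i := by
  simp [weightMeasure, lintegral_finsetSum_measure, lintegral_smul_measure]

lemma integral_weightMeasure {w : ι → ℝ} (hw : ∀ i, 0 ≤ w i) (f : ι → ℝ) :
    ∫ i, f i ∂(weightMeasure w) = ∑ i, w i * f i := by
  rw [weightMeasure, integral_finsetSum_measure]
  · simp [integral_smul_measure, hw]
  · intro i _
    exact (integrable_dirac (by simp)).smul_measure ENNReal.ofReal_ne_top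

variable {w v : ι → ℝ}

lemma weightMeasure_eq_withDensity (hv : ∀ i, 0 ≤ v i) (h : ∀ i, 0 < w i → 0 < v i) :
    weightMeasure w = (weightMeasure v).withDensity (fun i => ENNReal.ofReal (w i / v i)) := by
  refine Measure.ext_of_lintegral _ fun f hf => ?_
  rw [lintegral_withDensity_eq_lintegral_mul _ (measurable_of_finite _) hf,
    lintegral_weightMeasure, lintegral_weightMeasure]
  refine Finset.sum_congr rfl fun i _ => ?_
  rw [Pi.mul_apply, ← mul_assoc, ← ENNReal.ofReal_mul (hv i)]
  -- where `v i = 0`, the junk value `w i / 0 = 0` is harmless since `w i ≤ 0` there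
  rcases (hv i).eq_or_lt with h0 | h0
  · have : w i ≤ 0 := not_lt.1 fun hw => (h i hw).ne h0
    simp [← h0, ENNReal.ofReal_of_nonpos this]
  · rw [mul_div_cancel₀ _ h0.ne']

lemma klDiv_weightMeasure (hw : ∀ i, 0 ≤ w i) (hv : ∀ i, 0 ≤ v i) (hsum : ∑ i, w i = ∑ i, v i)
    (h : ∀ i, 0 < w i → 0 < v i) :
    klDiv (weightMeasure w) (weightMeasure v) ≠ ∞ ∧
      (klDiv (weightMeasure w) (weightMeasure v)).toReal =
        ∑ i, w i * Real.log (w i / v i) := by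
  have hd := weightMeasure_eq_withDensity hv h
  have hac : weightMeasure w ≪ weightMeasure v := by
    rw [hd]; exact withDensity_absolutelyContinuous _ _
  have hu : weightMeasure w Set.univ = weightMeasure v Set.univ := by
    simp only [← lintegral_one, lintegral_weightMeasure, mul_one]
    rw [← ENNReal.ofReal_sum_of_nonneg fun i _ => hw i,
      ← ENNReal.ofReal_sum_of_nonneg fun i _ => hv i, hsum]
  refine ⟨klDiv_ne_top hac .of_finite, ?_⟩
  rw [toReal_klDiv_of_measure_eq hac hu, ← integral_weightMeasure hw]
  refine integral_congr_ae ?_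
  have hr : (weightMeasure w).rnDeriv (weightMeasure v)
      =ᵐ[weightMeasure v] fun i => ENNReal.ofReal (w i / v i) := by
    conv_lhs => rw [hd]
    exact Measure.rnDeriv_withDensity _ (measurable_of_finite _)
  filter_upwards [hac.ae_le hr] with i hi
  rw [llr, hi, ENNReal.toReal_ofReal (div_nonneg (hw i) (hv i))]

end Discrete

end InformationTheory

namespace ProbabilityTheory

/-! ### Log-densities of quadratic growth -/

section LogDensity

variable {E F : Type*} [NormedAddCommGroup E] [MeasurableSpace E]
  [NormedAddCommGroup F] [MeasurableSpace F]

/-- `μ` has a density `exp f` relative to `lam` with `f` of at most quadratic growth. Normalizing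
constants are absorbed into `f`, so none needs to be computed. -/
def HasQuadraticLogDensity (lam μ : Measure E) : Prop :=
  ∃ f : E → ℝ, Measurable f ∧ (∃ C, ∀ x, |f x| ≤ C * (1 + ‖x‖ ^ 2)) ∧
    μ = lam.withDensity (fun x => ENNReal.ofReal (Real.exp (f x)))

namespace HasQuadraticLogDensity

lemma map_continuousLinearEquiv [NormedSpace ℝ E] [BorelSpace E] [FiniteDimensional ℝ E]
    {lam μ : Measure E}
    [lam.IsAddHaarMeasure] (h : HasQuadraticLogDensity lam μ) (L : E ≃L[ℝ] E) :
    HasQuadraticLogDensity lam (μ.map L) := by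
  obtain ⟨f, hf, ⟨C, hC⟩, rfl⟩ := h
  have hC0 : 0 ≤ C := by simpa using (abs_nonneg _).trans (hC 0)
  have hLm : Measurable L := L.continuous.measurable
  have hLm' : Measurable L.symm := L.symm.continuous.measurable
  obtain ⟨c, hc0, hc⟩ : ∃ c : ℝ, 0 < c ∧ lam.map L = ENNReal.ofReal c • lam := by
    have hdet : LinearMap.det (L.toLinearEquiv : E →ₗ[ℝ] E) ≠ 0 :=
      (LinearEquiv.isUnit_det' _).ne_zero
    exact ⟨_, abs_pos.2 (inv_ne_zero hdet), Measure.map_linearMap_addHaar_eq_smul_addHaar lam hdet⟩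
  refine ⟨fun x => f (L.symm x) + Real.log c, (hf.comp hLm').add_const _,
    ⟨C * (1 + ‖(L.symm : E →L[ℝ] E)‖ ^ 2) + |Real.log c|, fun x => ?_⟩, ?_⟩
  · have h1 : ‖L.symm x‖ ≤ ‖(L.symm : E →L[ℝ] E)‖ * ‖x‖ := (L.symm : E →L[ℝ] E).le_opNorm x
    have h2 : ‖L.symm x‖ ^ 2 ≤ ‖(L.symm : E →L[ℝ] E)‖ ^ 2 * ‖x‖ ^ 2 := by
      rw [← mul_pow]; gcongr
    have h3 := (hC (L.symm x)).trans (mul_le_mul_of_nonneg_left (add_le_add_right h2 1) hC0)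
    have h4 := abs_add_le (f (L.symm x)) (Real.log c)
    have h5 : 0 ≤ C * ‖x‖ ^ 2 := by positivity
    have h6 : 0 ≤ C * ‖(L.symm : E →L[ℝ] E)‖ ^ 2 := by positivity
    have h7 : 0 ≤ |Real.log c| * ‖x‖ ^ 2 := by positivity
    nlinarith
  · ext s hs
    rw [Measure.map_apply hLm hs, withDensity_apply _ (hLm hs), withDensity_apply _ hs]
    have hg : Measurable fun x => ENNReal.ofReal (Real.exp (f (L.symm x))) :=
      (Real.measurable_exp.comp (hf.comp hLm')).ennreal_ofReal
    have h1 := setLIntegral_map (μ := lam) hs hg hLm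
    simp only [ContinuousLinearEquiv.symm_apply_apply] at h1
    rw [← h1, hc, Measure.restrict_smul, lintegral_smul_measure, smul_eq_mul,
      ← lintegral_const_mul _ hg]
    refine lintegral_congr fun x => ?_
    rw [← ENNReal.ofReal_mul hc0.le, Real.exp_add, Real.exp_log hc0, mul_comm]

lemma map_const_add [BorelSpace E] {lam μ : Measure E} [lam.IsAddLeftInvariant]
    (h : HasQuadraticLogDensity lam μ) (m : E) :
    HasQuadraticLogDensity lam (μ.map (fun x => m + x)) := by
  obtain ⟨f, hf, ⟨C, hC⟩, rfl⟩ := h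
  have hC0 : 0 ≤ C := by simpa using (abs_nonneg _).trans (hC 0)
  have hm : Measurable fun x : E => m + x := (continuous_const_add m).measurable
  have hm' : Measurable fun x : E => -m + x := (continuous_const_add (-m)).measurable
  refine ⟨fun x => f (-m + x), hf.comp hm', ⟨C * (2 + 2 * ‖m‖ ^ 2), fun x => ?_⟩, ?_⟩
  · have h1 : ‖-m + x‖ ≤ ‖m‖ + ‖x‖ := by simpa using norm_add_le (-m) x
    have h2 : ‖-m + x‖ ^ 2 ≤ 2 * ‖m‖ ^ 2 + 2 * ‖x‖ ^ 2 := by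
      nlinarith [norm_nonneg (-m + x), norm_nonneg m, norm_nonneg x, sq_nonneg (‖m‖ - ‖x‖)]
    refine (hC _).trans ?_
    rw [mul_assoc]
    refine mul_le_mul_of_nonneg_left ?_ hC0
    nlinarith [mul_nonneg (sq_nonneg ‖m‖) (sq_nonneg ‖x‖)]
  · ext s hs
    rw [Measure.map_apply hm hs, withDensity_apply _ (hm hs), withDensity_apply _ hs]
    have hg : Measurable fun x => ENNReal.ofReal (Real.exp (f (-m + x))) :=
      (Real.measurable_exp.comp (hf.comp hm')).ennreal_ofReal
    have h1 := setLIntegral_map (μ := lam) hs hg hm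
    simp only [neg_add_cancel_left, map_add_left_eq_self] at h1
    exact h1.symm

lemma prod {lam μ : Measure E} {lam' ν : Measure F} [SFinite lam] [SFinite lam']
    (hμ : HasQuadraticLogDensity lam μ) (hν : HasQuadraticLogDensity lam' ν) [SFinite μ]
    [SFinite ν] :
    HasQuadraticLogDensity (lam.prod lam') (μ.prod ν) := by
  obtain ⟨f, hf, ⟨C, hC⟩, rfl⟩ := hμ
  obtain ⟨g, hg, ⟨D, hD⟩, rfl⟩ := hν
  have hC0 : 0 ≤ C := by simpa using (abs_nonneg _).trans (hC 0)
  have hD0 : 0 ≤ D := by simpa using (abs_nonneg _).trans (hD 0)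
  refine ⟨fun p => f p.1 + g p.2, (hf.comp measurable_fst).add (hg.comp measurable_snd),
    ⟨C + D, fun p => ?_⟩, ?_⟩
  · rw [add_mul]
    refine (abs_add_le _ _).trans (add_le_add ((hC p.1).trans ?_) ((hD p.2).trans ?_))
    · gcongr; exact norm_fst_le p
    · gcongr; exact norm_snd_le p
  · have hf' : Measurable fun x => ENNReal.ofReal (Real.exp (f x)) :=
      (Real.measurable_exp.comp hf).ennreal_ofReal
    have hg' : Measurable fun x => ENNReal.ofReal (Real.exp (g x)) :=
      (Real.measurable_exp.comp hg).ennreal_ofReal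
    rw [prod_withDensity hf' hg']
    congr 1
    ext p
    rw [Real.exp_add, ENNReal.ofReal_mul (Real.exp_nonneg _)]

/-- The log-likelihood ratio grows at most quadratically, so a finite second moment bounds the
relative entropy. -/
lemma klDiv_ne_top {lam μ ν : Measure E} [SigmaFinite ν]
    (hμ : HasQuadraticLogDensity lam μ) (hν : HasQuadraticLogDensity lam ν) [IsFiniteMeasure μ]
    (h2 : Integrable (fun x => ‖x‖ ^ 2) μ) : klDiv μ ν ≠ ∞ := by
  obtain ⟨f, hf, ⟨C, hC⟩, hμf⟩ := hμ
  obtain ⟨g, hg, ⟨D, hD⟩, hνg⟩ := hν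
  have hme : ∀ {u : E → ℝ}, Measurable u → Measurable fun x => ENNReal.ofReal (Real.exp (u x)) :=
    fun hu => (Real.measurable_exp.comp hu).ennreal_ofReal
  have hd : μ = ν.withDensity (fun x => ENNReal.ofReal (Real.exp (f x - g x))) := by
    have hfg : Measurable fun x => f x - g x := hf.sub hg
    rw [hμf, hνg, ← withDensity_mul _ (hme hg) (hme hfg)]
    congr 1
    ext x
    rw [Pi.mul_apply, ← ENNReal.ofReal_mul (Real.exp_nonneg _), ← Real.exp_add, add_sub_cancel]
  have hac : μ ≪ ν := by rw [hd]; exact withDensity_absolutelyContinuous _ _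
  have hr : μ.rnDeriv ν =ᵐ[ν] fun x => ENNReal.ofReal (Real.exp (f x - g x)) := by
    conv_lhs => rw [hd]
    exact Measure.rnDeriv_withDensity _ (hme (hf.sub hg))
  refine InformationTheory.klDiv_ne_top hac ?_
  have hllr : llr μ ν =ᵐ[μ] fun x => f x - g x := by
    filter_upwards [hac.ae_le hr] with x hx
    rw [llr, hx, ENNReal.toReal_ofReal (Real.exp_nonneg _), Real.log_exp]
  rw [integrable_congr hllr]
  refine Integrable.mono' (((integrable_const (1 : ℝ)).add h2).const_mul (C + D))
    (hf.sub hg).aestronglyMeasurable (.of_forall fun x => ?_)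
  rw [Real.norm_eq_abs, Pi.add_apply, add_mul]
  exact (abs_sub _ _).trans (add_le_add (hC x) (hD x))

end HasQuadraticLogDensity

end LogDensity

/-! ### Densities of nondegenerate Gaussian laws -/

section Gaussian

variable {E : Type*} [NormedAddCommGroup E] [InnerProductSpace ℝ E] [FiniteDimensional ℝ E]
  [MeasurableSpace E] [BorelSpace E]

/-- The constant is identified by comparing characteristic functions. -/
lemma stdGaussian_eq_withDensity :
    ∃ c : ℝ, 0 < c ∧ stdGaussian E =
      volume.withDensity (fun x => ENNReal.ofReal (c * Real.exp (-(1 / 2) * ‖x‖ ^ 2))) := by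
  set I : ℝ := (Real.pi / (1 / 2)) ^ (Module.finrank ℝ E / 2 : ℝ) with hI
  have hI0 : 0 < I := by positivity
  have hint : Integrable (fun x : E => Real.exp (-(1 / 2) * ‖x‖ ^ 2)) := by
    -- the integral of a non-integrable function is `0`, whereas this one equals `I > 0`
    by_contra h
    have h1 := GaussianFourier.integral_rexp_neg_mul_sq_norm (V := E) (b := 1 / 2) (by norm_num)
    rw [integral_undef h] at h1
    exact hI0.ne h1
  have hfin : IsFiniteMeasure (volume.withDensity
      fun x : E => ENNReal.ofReal (I⁻¹ * Real.exp (-(1 / 2) * ‖x‖ ^ 2))) :=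
    isFiniteMeasure_withDensity_ofReal (hint.const_mul _).2
  refine ⟨I⁻¹, inv_pos.2 hI0, Measure.ext_of_charFun ?_⟩
  ext t
  rw [charFun_stdGaussian, charFun_apply, integral_withDensity_eq_integral_toReal_smul (by fun_prop)
    (.of_forall fun _ => ENNReal.ofReal_lt_top)]
  have hb : 0 < (1 / 2 : ℂ).re := by norm_num
  have h := GaussianFourier.integral_cexp_neg_mul_sq_norm_add hb Complex.I t
  have hIc : ((Real.pi : ℂ) / (1 / 2)) ^ (Module.finrank ℝ E / 2 : ℂ) = (I : ℂ) := by
    rw [hI, Complex.ofReal_cpow (by positivity)]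
    push_cast
    rfl
  rw [hIc] at h
  calc Complex.exp (-‖t‖ ^ 2 / 2)
      = (I : ℂ)⁻¹ * (I * Complex.exp (Complex.I ^ 2 * ‖t‖ ^ 2 / (4 * (1 / 2)))) := by
        rw [inv_mul_cancel_left₀ (by exact_mod_cast hI0.ne'), Complex.I_sq]
        congr 1
        ring
    _ = _ := by
        rw [← h, ← integral_const_mul]
        refine integral_congr_ae (.of_forall fun x => ?_)
        dsimp only
        rw [ENNReal.toReal_ofReal (by positivity), Complex.real_smul, Complex.exp_add,
          real_inner_comm]
        push_cast
        rw [mul_assoc, mul_comm Complex.I]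

lemma hasQuadraticLogDensity_stdGaussian :
    HasQuadraticLogDensity volume (stdGaussian E) := by
  obtain ⟨c, hc, h⟩ := stdGaussian_eq_withDensity (E := E)
  refine ⟨fun x => Real.log c + -(1 / 2) * ‖x‖ ^ 2, by fun_prop,
    ⟨|Real.log c| + 1, fun x => ?_⟩, ?_⟩
  · have h1 := abs_add_le (Real.log c) (-(1 / 2) * ‖x‖ ^ 2)
    rw [abs_of_nonpos (by nlinarith [sq_nonneg ‖x‖] : -(1 / 2) * ‖x‖ ^ 2 ≤ 0)] at h1
    nlinarith [mul_nonneg (abs_nonneg (Real.log c)) (sq_nonneg ‖x‖), sq_nonneg ‖x‖]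
  · rw [h]
    congr 1
    ext x
    simp only [Real.exp_add, Real.exp_log hc]

open scoped MatrixOrder in
lemma hasQuadraticLogDensity_multivariateGaussian {ι : Type*} [Fintype ι] [DecidableEq ι]
    (m : EuclideanSpace ℝ ι) {S : Matrix ι ι ℝ} (hS : S.PosDef) :
    HasQuadraticLogDensity volume (multivariateGaussian m S) := by
  have hu : IsUnit (CFC.sqrt S) := by
    rw [Matrix.isUnit_iff_isUnit_det, isUnit_iff_ne_zero]
    intro h0
    have h := congrArg Matrix.det (CFC.sqrt_mul_sqrt_self S hS.posSemidef.nonneg)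
    rw [Matrix.det_mul, h0, mul_zero] at h
    exact hS.det_pos.ne h
  obtain ⟨u, hu'⟩ := hu.map (Matrix.toEuclideanCLM (n := ι) (𝕜 := ℝ))
  let L := ContinuousLinearEquiv.unitsEquiv ℝ _ u
  have hL : ∀ x, L x = Matrix.toEuclideanCLM (n := ι) (𝕜 := ℝ) (CFC.sqrt S) x := fun x => by
    rw [← hu']; rfl
  have h := ((hasQuadraticLogDensity_stdGaussian
    (E := EuclideanSpace ℝ ι)).map_continuousLinearEquiv L).map_const_add m
  rw [Measure.map_map (by fun_prop) (by fun_prop)] at h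
  simpa only [multivariateGaussian, Function.comp_def, hL] using h

lemma integrable_norm_sq_of_isGaussian (μ : Measure E) [IsGaussian μ] :
    Integrable (fun x => ‖x‖ ^ 2) μ := by
  have h : MemLp id 2 μ := IsGaussian.memLp_two_id
  exact h.integrable_norm_pow (by norm_num)

end Gaussian
end ProbabilityTheory

namespace LiftedBridge

/-! ### Finite entropy of the pairwise bridges -/

section Reference

variable {d : ℕ}

lemma measurable_eval_pathSpace (t : unitInterval) : Measurable fun x : PathSpace d => x t :=
  (continuous_eval_const t).measurable

lemma IsWienerMeasure.map_eval_one {W : ProbabilityMeasure (PathSpace d)}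
    (hW : IsWienerMeasure W) :
    (W : Measure (PathSpace d)).map (fun w => w 1) = stdGaussian (State d) := by
  have h := hW.increment_law 0 1 zero_le_one
  simp only [Set.Icc.coe_one, Set.Icc.coe_zero, sub_zero, one_smul,
    multivariateGaussian_zero_one] at h
  rw [← h]
  refine Measure.map_congr ?_
  filter_upwards [hW.start_zero] with w hw
  rw [hw, sub_zero]

/-- The linear shear `(x, u) ↦ (x, x + c u)`. -/
noncomputable def shear (d : ℕ) {c : ℝ} (hc : c ≠ 0) :
    (State d × State d) ≃L[ℝ] (State d × State d) :=
  ContinuousLinearEquiv.equivOfInverse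
    ((ContinuousLinearMap.fst ℝ _ _).prod
      (ContinuousLinearMap.fst ℝ _ _ + c • ContinuousLinearMap.snd ℝ _ _))
    ((ContinuousLinearMap.fst ℝ _ _).prod
      (c⁻¹ • (ContinuousLinearMap.snd ℝ _ _ - ContinuousLinearMap.fst ℝ _ _)))
    (fun p => by simp [hc]) (fun p => by simp [hc])

lemma shear_apply {c : ℝ} (hc : c ≠ 0) (p : State d × State d) :
    shear d hc p = (p.1, p.1 + c • p.2) := rfl

/-- The endpoints of the reference path are `x` and `x + √ε u` with `u` standard Gaussian
independent of `x`. -/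
lemma map_endpoints_referenceLaw (ε : ℝ) (hε : 0 < ε) {W : ProbabilityMeasure (PathSpace d)}
    (hW : IsWienerMeasure W) (ν : ProbabilityMeasure (State d)) :
    (referenceLaw ε W ν : Measure (PathSpace d)).map (fun x => (x 0, x 1)) =
      ((ν : Measure (State d)).prod (stdGaussian (State d))).map
        (shear d (Real.sqrt_pos.2 hε).ne') := by
  have he : Measurable fun x : PathSpace d => (x 0, x 1) :=
    (measurable_eval_pathSpace 0).prodMk (measurable_eval_pathSpace 1)
  have h1 : Measurable (Prod.map id (fun w : PathSpace d => w 1) :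
      State d × PathSpace d → State d × State d) :=
    measurable_id.prodMap (measurable_eval_pathSpace 1)
  change (((ν : Measure (State d)).prod (W : Measure (PathSpace d))).map
    (uncontrolledPath ε)).map _ = _
  rw [Measure.map_map he (measurable_uncontrolledPath ε), ← hW.map_eval_one]
  conv_rhs => rw [← Measure.map_id (μ := (ν : Measure (State d)))]
  rw [Measure.map_prod_map _ _ measurable_id (measurable_eval_pathSpace 1),
    Measure.map_map (shear d _).continuous.measurable h1]
  refine Measure.map_congr ?_
  have h0 : ∀ᵐ q ∂((ν : Measure (State d)).prod (W : Measure (PathSpace d))), q.2 0 = 0 :=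
    Measure.quasiMeasurePreserving_snd.ae hW.start_zero
  filter_upwards [h0] with q hq
  simp [shear_apply, uncontrolledPath, hq]

/-- Reweighting the reference law so that its endpoints become independent with the prescribed
Gaussian laws costs finite entropy, so the bridge, being optimal, has finite entropy as well. -/
lemma IsSchrodingerBridge.klDiv_ne_top {ε : ℝ} (hε : 0 < ε) {W : ProbabilityMeasure (PathSpace d)}
    (hW : IsWienerMeasure W) {m₀ m₁ : State d} {S₀ S₁ : Matrix (Fin d) (Fin d) ℝ}
    (hS₀ : S₀.PosDef) (hS₁ : S₁.PosDef) {P : ProbabilityMeasure (PathSpace d)}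
    (hP : IsSchrodingerBridge (referenceLaw ε W (gaussian m₀ S₀)) (gaussian m₀ S₀)
      (gaussian m₁ S₁) P) :
    klDiv (P : Measure (PathSpace d)) (referenceLaw ε W (gaussian m₀ S₀)) ≠ ∞ := by
  have he : Measurable fun x : PathSpace d => (x 0, x 1) :=
    (measurable_eval_pathSpace 0).prodMk (measurable_eval_pathSpace 1)
  set μ := multivariateGaussian m₀ S₀ with hμ
  set ν := multivariateGaussian m₁ S₁ with hν
  have hμd : HasQuadraticLogDensity volume μ := hasQuadraticLogDensity_multivariateGaussian m₀ hS₀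
  have hνd : HasQuadraticLogDensity volume ν := hasQuadraticLogDensity_multivariateGaussian m₁ hS₁
  have hR : HasQuadraticLogDensity ((volume : Measure (State d)).prod volume)
      ((referenceLaw ε W (gaussian m₀ S₀) : Measure (PathSpace d)).map fun x => (x 0, x 1)) := by
    rw [map_endpoints_referenceLaw ε hε hW]
    exact (hμd.prod hasQuadraticLogDensity_stdGaussian).map_continuousLinearEquiv _
  have hRprob := Measure.isProbabilityMeasure_map (he.aemeasurable (μ :=
    (referenceLaw ε W (gaussian m₀ S₀) : Measure (PathSpace d))))
  have h2 : Integrable (fun p : State d × State d => ‖p‖ ^ 2) (μ.prod ν) := by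
    refine Integrable.mono' (((integrable_norm_sq_of_isGaussian μ).comp_fst ν).add
      ((integrable_norm_sq_of_isGaussian ν).comp_snd μ)) (by fun_prop) (.of_forall fun p => ?_)
    rw [Real.norm_of_nonneg (by positivity), Pi.add_apply, Prod.norm_def]
    rcases max_choice ‖p.1‖ ‖p.2‖ with h | h <;> rw [h] <;>
      nlinarith [sq_nonneg ‖p.1‖, sq_nonneg ‖p.2‖]
  obtain ⟨Q, hQ, hQe, hQR⟩ := exists_map_eq_and_klDiv_ne_top he
    ((hμd.prod hνd).klDiv_ne_top hR h2)
  refine ne_top_of_le_ne_top hQR (hP.2 ⟨Q, hQ⟩ ⟨?_, ?_⟩)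
  · have h := congrArg Measure.fst hQe
    rw [Measure.fst_prod, Measure.fst, Measure.map_map measurable_fst he] at h
    exact h
  · have h := congrArg Measure.snd hQe
    rw [Measure.snd_prod, Measure.snd, Measure.map_map measurable_snd he] at h
    exact h

end Reference

/-! ### The two disintegrations of the lifted laws -/

section Lifted

variable {d N₁ N₂ : ℕ}

/-- The kernel `(i, j) ↦ Q^{ij}` from labels to paths. -/
noncomputable def componentKernel (Q : Fin N₁ → Fin N₂ → ProbabilityMeasure (PathSpace d)) :
    Kernel (Label N₁ N₂) (PathSpace d) where
  toFun z := Q z.1 z.2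
  measurable' := measurable_of_finite _

instance (Q : Fin N₁ → Fin N₂ → ProbabilityMeasure (PathSpace d)) :
    IsMarkovKernel (componentKernel Q) :=
  ⟨fun z => inferInstanceAs (IsProbabilityMeasure (Q z.1 z.2 : Measure (PathSpace d)))⟩

lemma componentKernel_apply (Q : Fin N₁ → Fin N₂ → ProbabilityMeasure (PathSpace d))
    (z : Label N₁ N₂) : componentKernel Q z = (Q z.1 z.2 : Measure (PathSpace d)) := rfl

lemma liftedLaw_eq_compProd (π : Matrix (Fin N₁) (Fin N₂) ℝ)
    (Q : Fin N₁ → Fin N₂ → ProbabilityMeasure (PathSpace d)) :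
    liftedLaw π Q =
      weightMeasure (fun z : Label N₁ N₂ => π z.1 z.2) ⊗ₘ componentKernel Q := by
  refine Measure.ext_of_lintegral _ fun f hf => ?_
  rw [Measure.lintegral_compProd hf, lintegral_weightMeasure, Fintype.sum_prod_type]
  simp only [liftedLaw, lintegral_finsetSum_measure, lintegral_smul_measure, smul_eq_mul,
    componentKernel_apply, Measure.dirac_prod]
  refine Finset.sum_congr rfl fun i _ => Finset.sum_congr rfl fun j _ => ?_
  rw [lintegral_map hf (by fun_prop)]

/-- The relative entropy of lifted laws splits into the entropy of the label laws and the average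
entropy of the components. -/
lemma klDiv_liftedLaw {π η : Matrix (Fin N₁) (Fin N₂) ℝ}
    {P R : Fin N₁ → Fin N₂ → ProbabilityMeasure (PathSpace d)}
    (hπ : ∀ i j, 0 ≤ π i j) (hη : ∀ i j, 0 ≤ η i j)
    (hsum : ∑ i, ∑ j, π i j = ∑ i, ∑ j, η i j) (hsupp : matrixSupport π ⊆ matrixSupport η)
    (hκ : ∀ i j, klDiv (P i j : Measure (PathSpace d)) (R i j) ≠ ∞) :
    klDiv (liftedLaw π P) (liftedLaw η R) ≠ ∞ ∧
      (klDiv (liftedLaw π P) (liftedLaw η R)).toReal =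
        (∑ i, ∑ j, π i j * (klDiv (P i j : Measure (PathSpace d)) (R i j)).toReal) +
          couplingKL π η := by
  obtain ⟨h1, h2⟩ := klDiv_weightMeasure (w := fun z : Label N₁ N₂ => π z.1 z.2)
    (v := fun z => η z.1 z.2) (fun z => hπ _ _) (fun z => hη _ _)
    (by simpa only [Fintype.sum_prod_type] using hsum) (fun z hz => hsupp hz)
  have hac : ∀ z, componentKernel P z ≪ componentKernel R z := fun z =>
    (klDiv_ne_top_iff.1 (hκ z.1 z.2)).1
  rw [liftedLaw_eq_compProd, liftedLaw_eq_compProd, klDiv_compProd_eq_add,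
    klDiv_compProd_right_eq_lintegral (.of_forall hac), lintegral_weightMeasure]
  have hterm : ∀ z ∈ Finset.univ, ENNReal.ofReal (π z.1 z.2) *
      klDiv (componentKernel P z) (componentKernel R z) ≠ ∞ := fun z _ =>
    ENNReal.mul_ne_top ENNReal.ofReal_ne_top (hκ z.1 z.2)
  have h3 := ENNReal.sum_ne_top.2 hterm
  refine ⟨ENNReal.add_ne_top.2 ⟨h1, h3⟩, ?_⟩
  rw [ENNReal.toReal_add h1 h3, h2, ENNReal.toReal_sum hterm, add_comm, couplingKL,
    Fintype.sum_prod_type, Fintype.sum_prod_type]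
  simp only [ENNReal.toReal_mul, ENNReal.toReal_ofReal (hπ _ _), componentKernel_apply]

variable [NeZero N₁] [NeZero N₂]

instance (M : Measure (Label N₁ N₂ × PathSpace d)) [IsFiniteMeasure M] :
    IsFiniteMeasure (pathMarginal M) :=
  inferInstanceAs (IsFiniteMeasure (M.map Prod.snd))

instance (M : Measure (Label N₁ N₂ × PathSpace d)) [IsFiniteMeasure M] :
    IsMarkovKernel (labelPosterior M) :=
  inferInstanceAs (IsMarkovKernel (condDistrib Prod.fst Prod.snd M))

/-- Disintegration along the path; the factors are swapped because the label comes first in `M`. -/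
lemma pathMarginal_compProd_labelPosterior (M : Measure (Label N₁ N₂ × PathSpace d))
    [IsFiniteMeasure M] :
    pathMarginal M ⊗ₘ labelPosterior M = M.map MeasurableEquiv.prodComm :=
  compProd_map_condDistrib measurable_fst.aemeasurable

/-- **Projection-gap identity**, together with the absolute continuity of the posteriors. -/
lemma klDiv_eq_klDiv_pathMarginal_add_labelGap {M M' : Measure (Label N₁ N₂ × PathSpace d)}
    [IsFiniteMeasure M] [IsFiniteMeasure M'] (h : klDiv M M' ≠ ∞) :
    (∀ᵐ x ∂(pathMarginal M), labelPosterior M x ≪ labelPosterior M' x) ∧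
      klDiv M M' = klDiv (pathMarginal M) (pathMarginal M') + labelGap M M' := by
  have hac : pathMarginal M ⊗ₘ labelPosterior M ≪ pathMarginal M' ⊗ₘ labelPosterior M' := by
    rw [pathMarginal_compProd_labelPosterior, pathMarginal_compProd_labelPosterior]
    exact (klDiv_ne_top_iff.1 h).1.map MeasurableEquiv.prodComm.measurable
  have hae := hac.kernel_of_compProd
  refine ⟨hae, ?_⟩
  rw [labelGap, ← klDiv_compProd_right_eq_lintegral hae, ← klDiv_compProd_eq_add,
    pathMarginal_compProd_labelPosterior, pathMarginal_compProd_labelPosterior,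
    klDiv_map_measurableEquiv]

end Lifted

end LiftedBridge

/-! ### The projection-gap identity for the lifted bridge -/

theorem mainTheorem2 {d N₁ N₂ : ℕ} [NeZero N₁] [NeZero N₂]
    -- the noise level and the law of the driving standard Brownian motion
    (ε : ℝ) (hε : 0 < ε)
    (W : ProbabilityMeasure (LiftedBridge.PathSpace d)) (hW : LiftedBridge.IsWienerMeasure W)
    -- the two Gaussian mixtures
    (m₀ : Fin N₁ → LiftedBridge.State d) (S₀ : Fin N₁ → Matrix (Fin d) (Fin d) ℝ)
    (m₁ : Fin N₂ → LiftedBridge.State d) (S₁ : Fin N₂ → Matrix (Fin d) (Fin d) ℝ)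
    (hS₀ : ∀ i, (S₀ i).PosDef) (hS₁ : ∀ j, (S₁ j).PosDef)
    (α₀ : Fin N₁ → ℝ) (α₁ : Fin N₂ → ℝ)
    (hα₀ : ∀ i, 0 < α₀ i) (hα₁ : ∀ j, 0 < α₁ j)
    (hα₀_sum : ∑ i, α₀ i = 1) (hα₁_sum : ∑ j, α₁ j = 1)
    -- the uncontrolled component laws `R^i` and the pairwise Schrödinger bridges `P^{ij}`
    (R : Fin N₁ → ProbabilityMeasure (LiftedBridge.PathSpace d))
    (hR : ∀ i, R i = LiftedBridge.referenceLaw ε W (LiftedBridge.gaussian (m₀ i) (S₀ i)))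
    (P : Fin N₁ → Fin N₂ → ProbabilityMeasure (LiftedBridge.PathSpace d))
    (hP : ∀ i j, LiftedBridge.IsSchrodingerBridge (R i)
      (LiftedBridge.gaussian (m₀ i) (S₀ i)) (LiftedBridge.gaussian (m₁ j) (S₁ j)) (P i j))
    -- the couplings
    (π η : Matrix (Fin N₁) (Fin N₂) ℝ)
    (hπ : π ∈ LiftedBridge.couplings α₀ α₁) (hη : η ∈ LiftedBridge.couplings α₀ α₁)
    (hsupp : LiftedBridge.matrixSupport π ⊆ LiftedBridge.matrixSupport η) :
    let Pbar := LiftedBridge.liftedLaw π P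
    let Rbar := LiftedBridge.liftedLaw η (fun i _ => R i)
    let Q := LiftedBridge.pathMarginal Pbar
    let Rρ := LiftedBridge.pathMarginal Rbar
    let G := LiftedBridge.labelGap Pbar Rbar
    let κ : Fin N₁ → Fin N₂ → ℝ≥0∞ :=
      fun i j => klDiv (P i j : Measure (LiftedBridge.PathSpace d)) (R i)
    let C : Fin N₁ → Fin N₂ → ℝ := fun i j => ε * (κ i j).toReal
    -- the expected log-likelihood ratio of the posteriors is nonnegative, and it is the gap
    (0 ≤ ∫ x, (∫ z, llr (LiftedBridge.labelPosterior Pbar x) (LiftedBridge.labelPosterior Rbar x) z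
          ∂(LiftedBridge.labelPosterior Pbar x)) ∂Q ∧
      G = ENNReal.ofReal
        (∫ x, (∫ z, llr (LiftedBridge.labelPosterior Pbar x) (LiftedBridge.labelPosterior Rbar x) z
          ∂(LiftedBridge.labelPosterior Pbar x)) ∂Q)) ∧
    -- the projection-gap identity
    klDiv Pbar Rbar = klDiv Q Rρ + G ∧
    -- every quantity in the real-valued identities below is finite
    (∀ i j, κ i j ≠ ∞) ∧ klDiv Pbar Rbar ≠ ∞ ∧ klDiv Q Rρ ≠ ∞ ∧ G ≠ ∞ ∧
    (klDiv Q Rρ).toReal =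
      (∑ i, ∑ j, π i j * (κ i j).toReal) + LiftedBridge.couplingKL π η - G.toReal ∧
    ε * (klDiv Q Rρ).toReal =
      (∑ i, ∑ j, π i j * C i j) + ε * LiftedBridge.couplingKL π η - ε * G.toReal := by
  obtain ⟨hπ0, hπr, -⟩ := hπ
  obtain ⟨hη0, hηr, -⟩ := hη
  intro Pbar Rbar Q Rρ G κ C
  have hκ : ∀ i j, κ i j ≠ ∞ := fun i j => by
    have h := hP i j
    simp only [κ]
    rw [hR i] at h ⊢
    exact h.klDiv_ne_top hε hW (hS₀ i) (hS₁ j)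
  obtain ⟨hfin, hval⟩ := LiftedBridge.klDiv_liftedLaw (R := fun i _ => R i) hπ0 hη0
    (by simp only [hπr, hηr]) hsupp hκ
  obtain ⟨hac, hgap⟩ := LiftedBridge.klDiv_eq_klDiv_pathMarginal_add_labelGap hfin
  obtain ⟨hQ, hG⟩ := ENNReal.add_ne_top.1 (hgap ▸ hfin)
  have hint := integral_integral_llr_eq_toReal hac hG
  have hproj : (klDiv Q Rρ).toReal =
      (∑ i, ∑ j, π i j * (κ i j).toReal) + LiftedBridge.couplingKL π η - G.toReal := by
    rw [← hval, hgap, ENNReal.toReal_add hQ hG]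
    exact (add_sub_cancel_right _ _).symm
  refine ⟨⟨?_, ?_⟩, hgap, hκ, hfin, hQ, hG, hproj, ?_⟩
  · exact hint.symm ▸ ENNReal.toReal_nonneg
  · exact (hint.symm ▸ ENNReal.ofReal_toReal hG).symm
  · simp only [hproj, C, mul_sub, mul_add, Finset.mul_sum, mul_left_comm ε]
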